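/- Let $n\ge 1$. For $m\ge 1$ let $\mathbb T_m(\mathbb R)$ be the set of real lower triangular $m\times m$ matrices all of whose diagonal entries are equal, let $\mathbb S$ be the set of real $2\times 2$ matrices $\begin{bmatrix}\alpha&\beta\\-\beta&\alpha\end{bmatrix}$, and let $\mathbb B_m(\mathbb R)$ be the set of real $2m\times 2m$ matrices which, written in $2\times2$ blocks, are block lower triangular with all blocks on and below the diagonal in $\mathbb S$ and all diagonal blocks equal. Let $r,s\ge 0$ be integers, and let $\eta=(n_1,\dots,n_r;\,m_1,\dots,m_s)$ be a sequence of positive integers with $(n_1+\dots+n_r)+2(m_1+\dots+m_s)=n$. Let $$\mathcal K_{\eta,r,s}(\mathbb R)=\mathbb T_{n_1}(\mathbb R)\oplus\dots\oplus\mathbb T_{n_r}(\mathbb R)\oplus\mathbb B_{m_1}(\mathbb R)\oplus\dots\oplus\mathbb B_{m_s}(\mathbb R)$$ be the corresponding set of block diagonal $n\times n$ matrices, and $\mathcal K^*_{\eta,r,s}(\mathbb R)=\mathcal K_{\eta,r,s}(\mathbb R)\cap \mathrm{GL}(n,\mathbb R)$. Let $G$ be an abelian subgroup of $\mathrm{GL}(n,\mathbb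 R)$ and let $P\in \mathrm{GL}(n,\mathbb R)$ be such that $P^{-1}GP\subset\mathcal K^*_{\eta,r,s}(\mathbb R)$. If $G$ is generated (as a group) by $p$ matrices with $p\le n-s$, then for every $v\in\mathbb R^n$ the orbit $G(v)=\{Av: A\in G\}$ is nowhere dense in $\mathbb R^n$, that is, its closure has empty interior. In particular, $G$ is not topologically transitive, that is, no orbit $G(v)$ is dense in $\mathbb R^n$. -/

import Mathlib

open Matrix

/-- `𝕋_m(ℝ)`: the real lower triangular `m × m` matrices all of whose diagonal entries
are equal to one and the same number `μ`. -/
def triangularConst (m : ℕ) : Set (Matrix (Fin m) (Fin m) ℝ) :=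
  {M | ∃ μ : ℝ, (∀ i, M i i = μ) ∧ ∀ i j, i < j → M i j = 0}

/-- `𝕊`: the real `2 × 2` matrices of the form `[α, β; -β, α]`. -/
def similitudes : Set (Matrix (Fin 2) (Fin 2) ℝ) :=
  {C | ∃ α β : ℝ, C = !![α, β; -β, α]}

/-- The `2 × 2` block in position `(i, j)` of a matrix of size `2m`, whose rows and columns are
indexed by pairs (number of the block, position inside the block). -/
def twoBlock {m : ℕ} (M : Matrix (Fin m × Fin 2) (Fin m × Fin 2) ℝ) (i j : Fin m) :
    Matrix (Fin 2) (Fin 2) ℝ :=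
  M.submatrix (fun a => (i, a)) (fun b => (j, b))

/-- `𝔹_m(ℝ)`: the real matrices of size `2m` that are block lower triangular with `2 × 2` blocks
from `𝕊`, all diagonal blocks being equal to one and the same `C ∈ 𝕊`. -/
def blockTriangularConst (m : ℕ) : Set (Matrix (Fin m × Fin 2) (Fin m × Fin 2) ℝ) :=
  {M | ∃ C ∈ similitudes, (∀ i, twoBlock M i i = C) ∧
    (∀ i j, j < i → twoBlock M i j ∈ similitudes) ∧ ∀ i j, i < j → twoBlock M i j = 0}

/-- A sequence `η = (n_1, …, n_r; m_1, …, m_s)` of positive integers with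
`(n_1 + … + n_r) + 2 (m_1 + … + m_s) = n`. -/
structure BlockSizes (n r s : ℕ) where
  realSize : Fin r → ℕ
  complexSize : Fin s → ℕ
  realSize_pos : ∀ k, 0 < realSize k
  complexSize_pos : ∀ l, 0 < complexSize l
  sum_eq : ∑ k, realSize k + 2 * ∑ l, complexSize l = n

namespace BlockSizes

variable {n r s : ℕ}

theorem sum_eq' (η : BlockSizes n r s) :
    ∑ k, η.realSize k + ∑ l, η.complexSize l * 2 = n := by
  rw [← Finset.sum_mul, mul_comm]
  exact η.sum_eq

/-- The rows (and columns) of a block diagonal matrix of type `η`. -/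
abbrev Index (η : BlockSizes n r s) : Type :=
  (Σ k : Fin r, Fin (η.realSize k)) ⊕ (Σ l : Fin s, Fin (η.complexSize l) × Fin 2)

/-- The numbering of these rows by `0, …, n - 1` in their natural (lexicographic) order. -/
def indexEquiv (η : BlockSizes n r s) : η.Index ≃ Fin n :=
  (((Equiv.sumCongr finSigmaFinEquiv
    ((Equiv.sigmaCongrRight fun _ => finProdFinEquiv).trans finSigmaFinEquiv)).trans
      finSumFinEquiv).trans (finCongr η.sum_eq'))

/-- `𝒦_{η,r,s}(ℝ) = 𝕋_{n_1}(ℝ) ⊕ … ⊕ 𝕋_{n_r}(ℝ) ⊕ 𝔹_{m_1}(ℝ) ⊕ … ⊕ 𝔹_{m_s}(ℝ)`, as a set of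
block diagonal `n × n` matrices. -/
def K (η : BlockSizes n r s) : Set (Matrix (Fin n) (Fin n) ℝ) :=
  {M | ∃ (T : ∀ k : Fin r, Matrix (Fin (η.realSize k)) (Fin (η.realSize k)) ℝ)
      (B : ∀ l : Fin s,
        Matrix (Fin (η.complexSize l) × Fin 2) (Fin (η.complexSize l) × Fin 2) ℝ),
    (∀ k, T k ∈ triangularConst (η.realSize k)) ∧
    (∀ l, B l ∈ blockTriangularConst (η.complexSize l)) ∧
    M = Matrix.reindex η.indexEquiv η.indexEquiv
      (Matrix.fromBlocks (Matrix.blockDiagonal' T) 0 0 (Matrix.blockDiagonal' B))}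

/-- `𝒦*_{η,r,s}(ℝ) = 𝒦_{η,r,s}(ℝ) ∩ GL(n, ℝ)`. -/
def KStar (η : BlockSizes n r s) : Set (GL (Fin n) ℝ) :=
  {A | (A : Matrix (Fin n) (Fin n) ℝ) ∈ η.K}

end BlockSizes

/-- The orbit `G(v) = {A v : A ∈ G}` of a vector `v ∈ ℝⁿ` under the natural linear action. -/
def linearOrbit {n : ℕ} (G : Subgroup (GL (Fin n) ℝ)) (v : Fin n → ℝ) : Set (Fin n → ℝ) :=
  {w | ∃ A ∈ G, w = (A : Matrix (Fin n) (Fin n) ℝ) *ᵥ v}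

/-- `G` is topologically transitive: some orbit of the natural action on `ℝⁿ` is dense. -/
def IsTopologicallyTransitive {n : ℕ} (G : Subgroup (GL (Fin n) ℝ)) : Prop :=
  ∃ v : Fin n → ℝ, Dense (linearOrbit G v)

/-! Suppose some orbit `G(v)` is somewhere dense, and let `S` be the commutative real algebra
generated by `G`. The orbit then spans `ℝⁿ`, so `v` is a cyclic vector for `S`. By commutativity `a
↦ a v` is an isomorphism `S ≃ ℝⁿ`, hence `dim S = n` and `G` is a somewhere dense group of units of
`S`. Exponentiation is an open homomorphism from the additive group of `S` to its units, so the
logarithms of `G` form a dense additive subgroup `H` (`dense_exp_preimage`). The block form embeds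
`S` in an algebra with `r` real and `s` complex characters whose common kernel is nil. Only the
complex ones allow periods, in `2πiℤ`, so the kernel of the exponential has rank at most `s`
(`finite_and_finrank_ker_exp_le`) and `H` has rank at most `p + s ≤ n`. But a dense subgroup of an
`n`-dimensional space has rank at least `n + 1` (`finrank_lt_finrank_int_of_dense`). -/

/-! ### Ranks of finitely generated subgroups. -/

/-- A dense subgroup of finite rank of a nonzero finite-dimensional real vector space has rank
larger than the dimension of the space. -/
theorem finrank_lt_finrank_int_of_dense {E : Type*} [NormedAddCommGroup E] [NormedSpace ℝ E]
    [FiniteDimensional ℝ E] [Nontrivial E] (H : Submodule ℤ E) [Module.Finite ℤ H]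
    (hH : Dense (H : Set E)) : Module.finrank ℝ E < Module.finrank ℤ H := by
  by_contra! hle
  have : IsAddTorsionFree E := .of_isTorsionFree ℝ E
  have : Module.Free ℤ H := inferInstance
  let b := Module.finBasis ℤ H
  let w : Fin (Module.finrank ℤ H) → E := Subtype.val ∘ b
  have hspan : Submodule.span ℤ (Set.range w) = H := by
    have := congrArg (Submodule.map H.subtype) b.span_eq
    rw [Submodule.map_span, ← Set.range_comp] at this
    simpa using this
  have htop : Submodule.span ℝ (Set.range w) = ⊤ := by
    have hsub : (H : Set E) ⊆ Submodule.span ℝ (Set.range w) := by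
      exact (SetLike.coe_subset_coe.2 hspan.ge).trans
        (Submodule.span_subset_span ℤ ℝ (Set.range w))
    have hcl := (Submodule.closed_of_finiteDimensional
      (Submodule.span ℝ (Set.range w))).closure_subset_iff.2 hsub
    rw [hH.closure_eq] at hcl
    exact top_le_iff.1 fun x _ => hcl (Set.mem_univ x)
  -- At most `dim E` generators span `E` over `ℝ`, so they form a real basis and `H` is a lattice,
  -- which cannot be dense.
  have hcard : Fintype.card (Fin (Module.finrank ℤ H)) = Module.finrank ℝ E := by
    refine le_antisymm (by simpa using hle) ?_
    have := finrank_range_le_card (R := ℝ) w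
    rwa [Set.finrank, htop, finrank_top] at this
  let B := basisOfTopLeSpanOfCardEqFinrank w htop.ge hcard
  have hB : ∀ i, B i = w i := fun i => by simp [B]
  have hpos : 0 < Module.finrank ℤ H := by
    have := Module.finrank_pos (R := ℝ) (M := E)
    simp only [Fintype.card_fin] at hcard
    omega
  let i₀ : Fin (Module.finrank ℤ H) := ⟨0, hpos⟩
  have hcoord : Continuous (B.coord i₀) := LinearMap.continuous_of_finiteDimensional _
  have hint : (H : Set E) ⊆ B.coord i₀ ⁻¹' Set.range ((↑) : ℤ → ℝ) := by
    intro x hx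
    rw [SetLike.mem_coe, ← hspan] at hx
    induction hx using Submodule.span_induction with
    | mem x hx =>
      obtain ⟨j, rfl⟩ := hx
      rw [← hB j]
      by_cases h : j = i₀
      · exact ⟨1, by simp [h]⟩
      · exact ⟨0, by simp [h]⟩
    | zero => exact ⟨0, by simp⟩
    | add x y _ _ hx hy =>
      obtain ⟨a, ha⟩ := hx
      obtain ⟨c, hc⟩ := hy
      exact ⟨a + c, by rw [map_add, ← ha, ← hc]; push_cast; rfl⟩
    | smul k x _ hx =>
      obtain ⟨a, ha⟩ := hx
      exact ⟨k * a, by rw [map_zsmul, ← ha]; simp⟩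
  have hclosed : IsClosed (B.coord i₀ ⁻¹' Set.range ((↑) : ℤ → ℝ)) :=
    Int.isClosedEmbedding_coe_real.isClosed_range.preimage hcoord
  have huniv := hclosed.closure_subset_iff.2 hint
  rw [hH.closure_eq] at huniv
  -- By density the coordinate would be integral on all of `E`; half a basis vector refutes this.
  obtain ⟨k, hk⟩ := huniv (Set.mem_univ ((1 / 2 : ℝ) • B i₀))
  have : (k : ℝ) * 2 = 1 := by
    rw [hk]; simp
  have : k * 2 = 1 := by exact_mod_cast this
  omega

/-- If the kernel of a homomorphism of abelian groups is finitely generated and its range lies in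
a group generated by `p` elements, then the source is finitely generated, and its rank is at most
`p` plus the rank of the kernel. -/
theorem finite_and_finrank_le_of_range_le_span {M N : Type*} [AddCommGroup M] [AddCommGroup N]
    (f : M →ₗ[ℤ] N) {p : ℕ} (w : Fin p → N)
    (hf : LinearMap.range f ≤ Submodule.span ℤ (Set.range w)) [Module.Finite ℤ (LinearMap.ker f)] :
    Module.Finite ℤ M ∧ Module.finrank ℤ M ≤ p + Module.finrank ℤ (LinearMap.ker f) := by
  have : Module.Finite ℤ (Submodule.span ℤ (Set.range w)) :=
    Module.Finite.span_of_finite ℤ (Set.finite_range w)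
  have hr : Module.Finite ℤ (LinearMap.range f) :=
    Module.Finite.of_injective (Submodule.inclusion hf) (Submodule.inclusion_injective hf)
  have hM : Module.Finite ℤ M := by
    refine ⟨Submodule.fg_of_fg_map_of_fg_inf_ker f ?_ ?_⟩
    · rw [Submodule.map_top]
      exact Module.Finite.iff_fg.1 hr
    · rw [top_inf_eq]
      exact Module.Finite.iff_fg.1 inferInstance
  refine ⟨hM, ?_⟩
  have h1 := Submodule.finrank_quotient_add_finrank (LinearMap.ker f)
  rw [f.quotKerEquivRange.finrank_eq] at h1
  have h2 : Module.finrank ℤ (LinearMap.range f) ≤ p :=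
    (Submodule.finrank_mono hf).trans (by simpa [Set.finrank] using finrank_range_le_card (R := ℤ) w)
  omega

/-! ### The exponential map of a commutative Banach algebra. -/

section Exp

variable {A : Type*} [NormedCommRing A] [NormedAlgebra ℝ A] [CompleteSpace A]

theorem exp_mul_of_sq_mul_eq_zero {a x : A} (h : a ^ 2 * x = 0) :
    NormedSpace.exp a * x = x + a * x := by
  have h1 := (NormedSpace.exp_series_hasSum_exp' (𝕂 := ℝ) a).mul_right x
  have h2 : HasSum (fun k : ℕ => ((k.factorial : ℝ)⁻¹ • a ^ k) * x) (x + a * x) := by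
    have : x + a * x = ∑ k ∈ Finset.range 2, ((k.factorial : ℝ)⁻¹ • a ^ k) * x := by
      simp [Finset.sum_range_succ]
    rw [this]
    refine hasSum_sum_of_ne_finset_zero fun k hk => ?_
    obtain ⟨m, rfl⟩ := Nat.exists_eq_add_of_le (not_lt.1 (mt Finset.mem_range.2 hk))
    rw [smul_mul_assoc, pow_add, mul_right_comm, h, zero_mul, smul_zero]
  exact h1.unique h2

/-- If the nilpotency index were `k + 2`, multiplying `exp a = 1` by `a ^ k` would leave `a ^ k + a
^ (k + 1) = a ^ k`, contradicting minimality. -/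
theorem eq_zero_of_isNilpotent_of_exp_eq_one {a : A} (ha : IsNilpotent a)
    (h : NormedSpace.exp a = 1) : a = 0 := by
  classical
  have hmin := fun m => Nat.find_min ha (m := m)
  have hspec := Nat.find_spec ha
  generalize Nat.find ha = k at hmin hspec
  match k with
  | 0 =>
    rw [pow_zero] at hspec
    rw [← mul_one a, hspec, mul_zero]
  | 1 => simpa using hspec
  | k + 2 =>
    refine absurd ?_ (hmin (k + 1) (by omega))
    have := exp_mul_of_sq_mul_eq_zero (a := a) (x := a ^ k) (by rw [← pow_add, add_comm, hspec])
    rw [h, one_mul, left_eq_add] at this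
    rw [pow_succ', this]

/-- The derivative at `x` is multiplication by the unit `exp x`, hence surjective. -/
theorem isOpenMap_exp : IsOpenMap (NormedSpace.exp : A → A) := by
  refine isOpenMap_iff_nhds_le.2 fun x => ?_
  have hx : HasStrictFDerivAt (NormedSpace.exp : A → A) (NormedSpace.exp x • (1 : A →L[ℝ] A)) x :=
    hasStrictFDerivAt_exp
  refine (hx.map_nhds_eq_of_surj (LinearMap.range_eq_top.2 fun y => ?_)).ge
  let := NormedAlgebra.restrictScalars ℚ ℝ A
  refine ⟨NormedSpace.exp (-x) * y, ?_⟩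
  change NormedSpace.exp x * (NormedSpace.exp (-x) * y) = y
  rw [← mul_assoc, ← NormedSpace.exp_add, add_neg_cancel, NormedSpace.exp_zero, one_mul]

/-- The exponential map of a commutative Banach algebra as a homomorphism of groups. -/
noncomputable def expUnitsHom (A : Type*) [NormedCommRing A] [NormedAlgebra ℝ A]
    [CompleteSpace A] : A →+ Additive Aˣ :=
  letI := NormedAlgebra.restrictScalars ℚ ℝ A
  { toFun := fun a => Additive.ofMul
      ⟨NormedSpace.exp a, NormedSpace.exp (-a),
        by rw [← NormedSpace.exp_add, add_neg_cancel, NormedSpace.exp_zero],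
        by rw [← NormedSpace.exp_add, neg_add_cancel, NormedSpace.exp_zero]⟩
    map_zero' := by
      apply Additive.toMul.injective
      ext
      exact NormedSpace.exp_zero
    map_add' := fun a b => by
      apply Additive.toMul.injective
      ext
      exact NormedSpace.exp_add }

theorem coe_expUnitsHom (a : A) : ((expUnitsHom A a).toMul : A) = NormedSpace.exp a := rfl

/-- The logarithms of the elements of a somewhere dense group of units are dense. -/
theorem dense_exp_preimage (Γ : Subgroup Aˣ)
    (hΓ : (interior (closure (Units.val '' (Γ : Set Aˣ)))).Nonempty) :
    Dense ((Γ.toAddSubgroup.comap (expUnitsHom A) : AddSubgroup A) : Set A) := by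
  set S : Set A := Units.val '' (Γ : Set Aˣ)
  set H : AddSubgroup A := Γ.toAddSubgroup.comap (expUnitsHom A)
  have hHS : (H : Set A) = NormedSpace.exp ⁻¹' S := by
    ext a
    constructor
    · intro ha
      exact ⟨(expUnitsHom A a).toMul, ha, rfl⟩
    · rintro ⟨u, hu, hua⟩
      have : (expUnitsHom A a).toMul = u := Units.ext hua.symm
      change (expUnitsHom A a).toMul ∈ Γ
      rwa [this]
  -- Some `g ∈ Γ` lies in the interior of the closure; translation by `g⁻¹` moves it to `1`.
  have h1 : closure S ∈ nhds (1 : A) := by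
    obtain ⟨x, hx⟩ := hΓ
    obtain ⟨_, hgU, g, hg, rfl⟩ :=
      mem_closure_iff.1 (interior_subset hx) _ isOpen_interior hx
    have hcont : Continuous fun y : A => (g : A) * y := continuous_const.mul continuous_id
    have hnhds : (fun y : A => (g : A) * y) ⁻¹' interior (closure S) ∈ nhds (1 : A) :=
      (isOpen_interior.preimage hcont).mem_nhds (by simpa using hgU)
    filter_upwards [hnhds] with y hy
    have hmem := map_mem_closure (f := fun y : A => ((g⁻¹ : Aˣ) : A) * y)
      (continuous_const.mul continuous_id) (interior_subset hy) (t := S) (by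
        rintro _ ⟨u, hu, rfl⟩
        exact ⟨g⁻¹ * u, Γ.mul_mem (Γ.inv_mem hg) hu, rfl⟩)
    simpa using hmem
  have h0 : closure (H : Set A) ∈ nhds (0 : A) := by
    let := NormedAlgebra.restrictScalars ℚ ℝ A
    rw [hHS]
    refine Filter.mem_of_superset ?_ isOpenMap_exp.preimage_closure_subset_closure_preimage
    refine NormedSpace.exp_continuous.continuousAt.preimage_mem_nhds ?_
    rwa [NormedSpace.exp_zero]
  -- The closure of `H` is a subgroup and a neighbourhood of `0`, so it is clopen in the connected
  -- space `A`.
  have hopen : IsOpen (H.topologicalClosure : Set A) :=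
    AddSubgroup.isOpen_of_mem_nhds _ h0
  have hclopen : IsClopen (closure (H : Set A)) := ⟨isClosed_closure, hopen⟩
  rw [dense_iff_closure_eq]
  exact hclopen.eq_univ ⟨0, mem_of_mem_nhds h0⟩

/-- The kernel of the exponential map of a commutative algebra all of whose characters belong to
`r` real and `s` complex ones is a free group of rank at most `s`. -/
theorem finite_and_finrank_ker_exp_le {r s : ℕ} [FiniteDimensional ℝ A]
    (ξ : Fin r → A →ₐ[ℝ] ℝ) (χ : Fin s → A →ₐ[ℝ] ℂ)
    (hnil : ∀ a, (∀ k, ξ k a = 0) → (∀ l, χ l a = 0) → IsNilpotent a) :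
    Module.Finite ℤ (LinearMap.ker (expUnitsHom A).toIntLinearMap) ∧
      Module.finrank ℤ (LinearMap.ker (expUnitsHom A).toIntLinearMap) ≤ s := by
  let := NormedAlgebra.restrictScalars ℚ ℝ A
  have hexp : ∀ a ∈ LinearMap.ker (expUnitsHom A).toIntLinearMap, NormedSpace.exp a = 1 := by
    intro a ha
    rw [← coe_expUnitsHom, show expUnitsHom A a = 0 from ha]
    rfl
  have hξ : ∀ k, ∀ a ∈ LinearMap.ker (expUnitsHom A).toIntLinearMap, ξ k a = 0 := by
    intro k a ha
    have := NormedSpace.map_exp (ξ k)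
      (LinearMap.continuous_of_finiteDimensional (ξ k).toLinearMap) a
    rw [hexp a ha, map_one, ← Real.exp_eq_exp_ℝ] at this
    exact (Real.exp_eq_one_iff _).1 this.symm
  have hχ : ∀ l, ∀ a ∈ LinearMap.ker (expUnitsHom A).toIntLinearMap,
      ∃ k : ℤ, χ l a = k * (2 * Real.pi * Complex.I) := by
    intro l a ha
    have := NormedSpace.map_exp (χ l)
      (LinearMap.continuous_of_finiteDimensional (χ l).toLinearMap) a
    rw [hexp a ha, map_one, ← Complex.exp_eq_exp_ℂ] at this
    exact Complex.exp_eq_one_iff.1 this.symm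
  -- The complex characters alone separate the kernel: the real ones vanish on it, so an element
  -- killed by `f` is nilpotent with exponential `1`.
  let f : LinearMap.ker (expUnitsHom A).toIntLinearMap →ₗ[ℤ] (Fin s → ℂ) :=
    (LinearMap.pi fun l => (χ l).toLinearMap.restrictScalars ℤ) ∘ₗ Submodule.subtype _
  have hker : LinearMap.ker f = ⊥ := by
    refine LinearMap.ker_eq_bot'.2 fun a ha => Subtype.ext ?_
    exact eq_zero_of_isNilpotent_of_exp_eq_one
      (hnil a (fun k => hξ k a a.2) fun l => congrFun ha l) (hexp a a.2)
  have hrange : LinearMap.range f ≤ Submodule.span ℤ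
      (Set.range fun l : Fin s => (Pi.single l (2 * Real.pi * Complex.I) : Fin s → ℂ)) := by
    rintro _ ⟨a, rfl⟩
    choose k hk using fun l => hχ l a a.2
    have : f a = ∑ l, k l • (Pi.single l (2 * Real.pi * Complex.I) : Fin s → ℂ) := by
      ext j
      rw [Finset.sum_apply]
      simp only [Pi.smul_apply, Pi.single_apply, smul_ite, smul_zero, Finset.sum_ite_eq,
        Finset.mem_univ, if_true, zsmul_eq_mul]
      exact hk j
    rw [this]
    exact Submodule.sum_mem _ fun l _ =>
      Submodule.smul_mem _ _ (Submodule.subset_span ⟨l, rfl⟩)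
  have : Module.Finite ℤ (LinearMap.ker f) := by rw [hker]; infer_instance
  obtain ⟨hfin, hle⟩ := finite_and_finrank_le_of_range_le_span f _ hrange
  refine ⟨hfin, ?_⟩
  rwa [hker, finrank_bot, add_zero] at hle

/-- A group of units of `A` generated by `p` elements is nowhere dense in `A` if `A` has `s` pairs
of complex conjugate characters and dimension at least `p + s`. -/
theorem isNowhereDense_units_closure {r s p : ℕ} [FiniteDimensional ℝ A] [Nontrivial A]
    (ξ : Fin r → A →ₐ[ℝ] ℝ) (χ : Fin s → A →ₐ[ℝ] ℂ)
    (hnil : ∀ a, (∀ k, ξ k a = 0) → (∀ l, χ l a = 0) → IsNilpotent a)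
    (g : Fin p → Aˣ) (hp : p + s ≤ Module.finrank ℝ A) :
    IsNowhereDense (Units.val '' (Subgroup.closure (Set.range g) : Set Aˣ)) := by
  set Γ := Subgroup.closure (Set.range g)
  by_contra hne
  have hdense := dense_exp_preimage Γ (Set.nonempty_iff_ne_empty.2 hne)
  let E := (expUnitsHom A).toIntLinearMap
  let H : Submodule ℤ A := (AddSubgroup.toIntSubmodule Γ.toAddSubgroup).comap E
  obtain ⟨hfin, hle⟩ := finite_and_finrank_ker_exp_le ξ χ hnil
  let f : H →ₗ[ℤ] Additive Aˣ := E ∘ₗ H.subtype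
  have hkl : ∀ x : LinearMap.ker f, ((x : H) : A) ∈ LinearMap.ker E := fun x => x.2
  -- Passing from `A` to `H` does not enlarge the kernel of the exponential.
  let ι : LinearMap.ker f →ₗ[ℤ] LinearMap.ker E :=
    (H.subtype ∘ₗ (LinearMap.ker f).subtype).codRestrict _ hkl
  have hι : Function.Injective ι := fun x y h =>
    Subtype.ext (Subtype.ext (congrArg (fun z : LinearMap.ker E => (z : A)) h))
  have : Module.Finite ℤ (LinearMap.ker f) := Module.Finite.of_injective ι hι
  have hker : Module.finrank ℤ (LinearMap.ker f) ≤ s :=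
    (LinearMap.finrank_le_finrank_of_injective hι).trans hle
  have hrange : LinearMap.range f ≤
      Submodule.span ℤ (Set.range fun i => Additive.ofMul (g i)) := by
    rintro _ ⟨a, rfl⟩
    have ha : f a ∈ Γ.toAddSubgroup := a.2
    rw [Subgroup.toAddSubgroup_closure] at ha
    rw [← SetLike.mem_coe, ← Submodule.coe_toAddSubgroup, Submodule.span_int_eq_addSubgroupClosure]
    exact ha
  obtain ⟨hHfin, hHle⟩ := finite_and_finrank_le_of_range_le_span f _ hrange
  have := finrank_lt_finrank_int_of_dense H hdense
  omega

theorem isNowhereDense_image_units_closure {r s p : ℕ} [FiniteDimensional ℝ A] [Nontrivial A]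
    {E : Type*} [NormedAddCommGroup E] [NormedSpace ℝ E] [FiniteDimensional ℝ E]
    (ξ : Fin r → A →ₐ[ℝ] ℝ) (χ : Fin s → A →ₐ[ℝ] ℂ)
    (hnil : ∀ a, (∀ k, ξ k a = 0) → (∀ l, χ l a = 0) → IsNilpotent a)
    (g : Fin p → Aˣ) (hp : p + s ≤ Module.finrank ℝ A) (e : A ≃ₗ[ℝ] E) :
    IsNowhereDense (e '' (Units.val '' (Subgroup.closure (Set.range g) : Set Aˣ))) := by
  let e' := e.toContinuousLinearEquiv.toHomeomorph
  have h := isNowhereDense_units_closure ξ χ hnil g hp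
  change interior (closure (e' '' _)) = ∅
  rw [← e'.image_closure, ← e'.image_interior, h, Set.image_empty]

end Exp

/-! ### Triangular matrices with constant diagonal. -/

section ConstTriangular

theorem lower_triangular_mul_apply_self {F : Type*} [Field F] {m : ℕ}
    {M N : Matrix (Fin m) (Fin m) F}
    (hM : ∀ i j, i < j → M i j = 0) (hN : ∀ i j, i < j → N i j = 0) (i : Fin m) :
    (M * N) i i = M i i * N i i := by
  rw [Matrix.mul_apply]
  refine Finset.sum_eq_single i (fun j _ hj => ?_) (by simp)
  rcases lt_or_gt_of_ne hj with h | h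
  · rw [hN _ _ h, mul_zero]
  · rw [hM _ _ h, zero_mul]

variable (F : Type*) [Field F] [Algebra ℝ F] (m : ℕ)

/-- The algebra of lower triangular matrices with entries in `F` and constant diagonal. -/
noncomputable def constTriangular : Subalgebra ℝ (Matrix (Fin m) (Fin m) F) where
  carrier := {M | (∀ i j, M i i = M j j) ∧ ∀ i j, i < j → M i j = 0}
  mul_mem' := by
    rintro M N ⟨hM, hM'⟩ ⟨hN, hN'⟩
    refine ⟨fun i j => ?_, fun i j hij => ?_⟩
    · rw [lower_triangular_mul_apply_self hM' hN', lower_triangular_mul_apply_self hM' hN',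
        hM i j, hN i j]
    · rw [Matrix.mul_apply]
      refine Finset.sum_eq_zero fun k _ => ?_
      rcases lt_or_ge i k with h | h
      · rw [hM' _ _ h, zero_mul]
      · rw [hN' _ _ (h.trans_lt hij), mul_zero]
  add_mem' := by
    rintro M N ⟨hM, hM'⟩ ⟨hN, hN'⟩
    refine ⟨fun i j => ?_, fun i j hij => ?_⟩
    · simp [hM i j, hN i j]
    · simp [hM' i j hij, hN' i j hij]
  algebraMap_mem' c := by
    refine ⟨fun i j => ?_, fun i j hij => ?_⟩
    · simp [Matrix.algebraMap_matrix_apply]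
    · simp [Matrix.algebraMap_matrix_apply, hij.ne]

variable {F m}

/-- The diagonal entry of a triangular matrix with constant diagonal. -/
noncomputable def constTriangular.diagEntry (hm : 0 < m) : constTriangular F m →ₐ[ℝ] F where
  toFun M := M.1 ⟨0, hm⟩ ⟨0, hm⟩
  map_one' := by simp
  map_mul' M N := lower_triangular_mul_apply_self M.2.2 N.2.2 _
  map_zero' := by simp
  map_add' M N := by simp
  commutes' c := by simp [Matrix.algebraMap_matrix_apply]

theorem constTriangular.pow_eq_zero (hm : 0 < m) {M : constTriangular F m}
    (h : constTriangular.diagEntry hm M = 0) {N : ℕ} (hN : m ≤ N) : M ^ N = 0 := by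
  have hM : ∀ i j : Fin m, i ≤ j → M.1 i j = 0 := by
    intro i j hij
    rcases hij.lt_or_eq with h' | rfl
    · exact M.2.2 i j h'
    · exact (M.2.1 i _).trans h
  -- Each factor of the strictly lower triangular `M` pushes the support one more diagonal down.
  have key : ∀ (k : ℕ) (i j : Fin m), (i : ℕ) < j + k → (M.1 ^ k) i j = 0 := by
    intro k
    induction k with
    | zero =>
      intro i j hij
      rw [pow_zero, Matrix.one_apply_ne]
      rintro rfl
      simp at hij
    | succ k ih =>
      intro i j hij
      rw [pow_succ, Matrix.mul_apply]
      refine Finset.sum_eq_zero fun l _ => ?_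
      rcases le_or_gt l j with hl | hl
      · rw [hM l j hl, mul_zero]
      · rw [ih i l (by have : (j : ℕ) < l := hl; omega), zero_mul]
  refine pow_eq_zero_of_le hN (Subtype.ext ?_)
  ext i j
  rw [SubmonoidClass.coe_pow]
  exact key m i j (by omega)

end ConstTriangular

/-! ### Complex blocks as real matrices. -/

/-- The representation of complex numbers by the real matrices `[α, β; -β, α]`. -/
noncomputable def complexToMatrix : ℂ →ₐ[ℝ] Matrix (Fin 2) (Fin 2) ℝ where
  toFun z := !![z.re, z.im; -z.im, z.re]
  map_one' := by ext i j; fin_cases i <;> fin_cases j <;> simp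
  map_mul' z w := by
    ext i j; fin_cases i <;> fin_cases j <;> simp [Matrix.mul_apply] <;> ring
  map_zero' := by ext i j; fin_cases i <;> fin_cases j <;> simp
  map_add' z w := by ext i j; fin_cases i <;> fin_cases j <;> simp <;> ring
  commutes' c := by
    ext i j; fin_cases i <;> fin_cases j <;> simp [Matrix.algebraMap_matrix_apply]

theorem complexToMatrix_apply (z : ℂ) : complexToMatrix z = !![z.re, z.im; -z.im, z.re] := rfl

/-- The representation of complex matrices by real matrices of twice the size. -/
noncomputable def realification (m : ℕ) :
    Matrix (Fin m) (Fin m) ℂ →ₐ[ℝ] Matrix (Fin m × Fin 2) (Fin m × Fin 2) ℝ :=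
  (Matrix.compAlgEquiv (Fin m) (Fin 2) ℝ ℝ).toAlgHom.comp complexToMatrix.mapMatrix

theorem realification_apply {m : ℕ} (M : Matrix (Fin m) (Fin m) ℂ) (i j : Fin m) (a b : Fin 2) :
    realification m M (i, a) (j, b) = complexToMatrix (M i j) a b := rfl

theorem realification_injective (m : ℕ) : Function.Injective (realification m) := by
  intro M N h
  ext i j
  have h0 := congrFun (congrFun h (i, 0)) (j, 0)
  have h1 := congrFun (congrFun h (i, 0)) (j, 1)
  simp only [realification_apply, complexToMatrix_apply] at h0 h1
  exact Complex.ext (by simpa using h0) (by simpa using h1)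

theorem exists_constTriangular_of_mem_triangularConst {m : ℕ} {T : Matrix (Fin m) (Fin m) ℝ}
    (hT : T ∈ triangularConst m) : ∃ x : constTriangular ℝ m, x = T := by
  obtain ⟨μ, hμ, h⟩ := hT
  exact ⟨⟨T, fun i j => (hμ i).trans (hμ j).symm, h⟩, rfl⟩

theorem exists_constTriangular_of_mem_blockTriangularConst {m : ℕ}
    {B : Matrix (Fin m × Fin 2) (Fin m × Fin 2) ℝ} (hB : B ∈ blockTriangularConst m) :
    ∃ x : constTriangular ℂ m, realification m x = B := by
  obtain ⟨C, hC, hdiag, hlow, hup⟩ := hB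
  have hblock : ∀ i j, twoBlock B i j ∈ similitudes := by
    intro i j
    rcases lt_trichotomy i j with h | rfl | h
    · rw [hup i j h]
      exact ⟨0, 0, by ext a b; fin_cases a <;> fin_cases b <;> simp⟩
    · rwa [hdiag i]
    · exact hlow i j h
  let z : Matrix (Fin m) (Fin m) ℂ := fun i j => ⟨twoBlock B i j 0 0, twoBlock B i j 0 1⟩
  have hz : z ∈ constTriangular ℂ m := by
    refine ⟨fun i j => ?_, fun i j hij => ?_⟩
    · simp only [z, hdiag]
    · simp only [z, hup i j hij]
      rfl
  refine ⟨⟨z, hz⟩, ?_⟩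
  ext ⟨i, a⟩ ⟨j, b⟩
  rw [realification_apply, complexToMatrix_apply]
  change _ = twoBlock B i j a b
  obtain ⟨α, β, h⟩ := hblock i j
  simp only [z, h]
  fin_cases a <;> fin_cases b <;> simp

/-! ### The block algebra and its characters. -/

namespace BlockSizes

variable {n r s : ℕ} (η : BlockSizes n r s)

/-- The abstract algebra `∏ 𝕋_{n_k}(ℝ) × ∏ 𝕋_{m_l}(ℂ)`. -/
abbrev BlockAlgebra : Type :=
  (∀ k, constTriangular ℝ (η.realSize k)) × (∀ l, constTriangular ℂ (η.complexSize l))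

/-- The representation of the abstract algebra by block diagonal real matrices. -/
noncomputable def toMatrix : η.BlockAlgebra →ₐ[ℝ] Matrix (Fin n) (Fin n) ℝ :=
  (Matrix.reindexAlgEquiv ℝ ℝ η.indexEquiv).toAlgHom.comp <| AlgHom.ofLinearMap
    { toFun := fun x => Matrix.fromBlocks (Matrix.blockDiagonal' fun k => (x.1 k).1) 0 0
        (Matrix.blockDiagonal' fun l => realification _ (x.2 l).1)
      map_add' := fun x y => by
        rw [Matrix.fromBlocks_add, ← Matrix.blockDiagonal'_add, ← Matrix.blockDiagonal'_add,
          add_zero, add_zero]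
        congr 2
        ext1 l
        exact map_add (realification _) _ _
      map_smul' := fun c x => by
        rw [RingHom.id_apply, Matrix.fromBlocks_smul, ← Matrix.blockDiagonal'_smul,
          ← Matrix.blockDiagonal'_smul, smul_zero, smul_zero]
        congr 2
        ext1 l
        exact map_smul (realification _) _ _ }
    (by
      change Matrix.fromBlocks _ _ _ _ = 1
      rw [← Matrix.fromBlocks_one, ← Matrix.blockDiagonal'_one, ← Matrix.blockDiagonal'_one]
      congr 2
      ext1 l
      exact map_one (realification _))
    (fun x y => by
      change Matrix.fromBlocks _ _ _ _ = Matrix.fromBlocks _ _ _ _ * Matrix.fromBlocks _ _ _ _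
      rw [Matrix.fromBlocks_multiply]
      simp only [add_zero, zero_add, ← Matrix.blockDiagonal'_mul, Matrix.mul_zero,
        Matrix.zero_mul]
      congr 2
      ext1 l
      exact map_mul (realification _) _ _)

theorem toMatrix_apply (x : η.BlockAlgebra) :
    η.toMatrix x = Matrix.reindex η.indexEquiv η.indexEquiv
      (Matrix.fromBlocks (Matrix.blockDiagonal' fun k => (x.1 k).1) 0 0
        (Matrix.blockDiagonal' fun l => realification _ (x.2 l).1)) := rfl

theorem toMatrix_injective : Function.Injective η.toMatrix := by
  intro x y h
  rw [toMatrix_apply, toMatrix_apply, (Matrix.reindex _ _).apply_eq_iff_eq,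
    Matrix.fromBlocks_inj] at h
  refine Prod.ext (funext fun k => Subtype.ext ?_) (funext fun l => Subtype.ext ?_)
  · exact congrFun (Matrix.blockDiagonal'_injective h.1) k
  · exact realification_injective _ (congrFun (Matrix.blockDiagonal'_injective h.2.2.2) l)

theorem K_subset_range_toMatrix {M : Matrix (Fin n) (Fin n) ℝ} (hM : M ∈ η.K) :
    ∃ x, η.toMatrix x = M := by
  obtain ⟨T, B, hT, hB, rfl⟩ := hM
  choose x hx using fun k => exists_constTriangular_of_mem_triangularConst (hT k)
  choose y hy using fun l => exists_constTriangular_of_mem_blockTriangularConst (hB l)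
  exact ⟨(x, y), by simp only [toMatrix_apply, hx, hy]⟩

/-- The real characters of the block algebra. -/
noncomputable def realChar (k : Fin r) : η.BlockAlgebra →ₐ[ℝ] ℝ :=
  (constTriangular.diagEntry (η.realSize_pos k)).comp
    ((Pi.evalAlgHom ℝ _ k).comp (AlgHom.fst ℝ _ _))

/-- The complex characters of the block algebra. -/
noncomputable def complexChar (l : Fin s) : η.BlockAlgebra →ₐ[ℝ] ℂ :=
  (constTriangular.diagEntry (η.complexSize_pos l)).comp
    ((Pi.evalAlgHom ℝ _ l).comp (AlgHom.snd ℝ _ _))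

theorem isNilpotent_of_char_eq_zero {x : η.BlockAlgebra} (hr : ∀ k, η.realChar k x = 0)
    (hs : ∀ l, η.complexChar l x = 0) : IsNilpotent x := by
  -- One exponent must kill all blocks at once; the sum of all sizes dominates each of them.
  have h1 : ∀ k, η.realSize k ≤ ∑ k, η.realSize k + ∑ l, η.complexSize l := fun k =>
    (Finset.single_le_sum (fun _ _ => Nat.zero_le _) (Finset.mem_univ k)).trans
      (Nat.le_add_right _ _)
  have h2 : ∀ l, η.complexSize l ≤ ∑ k, η.realSize k + ∑ l, η.complexSize l := fun l =>
    (Finset.single_le_sum (fun _ _ => Nat.zero_le _) (Finset.mem_univ l)).trans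
      (Nat.le_add_left _ _)
  exact ⟨_, Prod.ext
    (funext fun k => constTriangular.pow_eq_zero (η.realSize_pos k) (hr k) (h1 k))
    (funext fun l => constTriangular.pow_eq_zero (η.complexSize_pos l) (hs l) (h2 l))⟩

end BlockSizes

/-! ### From orbits to units of a commutative algebra. -/

section Orbit

attribute [local instance] Matrix.linftyOpNormedRing Matrix.linftyOpNormedAlgebra

theorem isNowhereDense_linearOrbit {n r s p : ℕ} (hn : 1 ≤ n) (η : BlockSizes n r s)
    (G : Subgroup (GL (Fin n) ℝ)) (hG : ∀ A ∈ G, ∀ B ∈ G, A * B = B * A)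
    (P : GL (Fin n) ℝ) (hP : ∀ A ∈ G, P⁻¹ * A * P ∈ η.KStar) (hp : p + s ≤ n)
    (g : Fin p → GL (Fin n) ℝ) (hgen : Subgroup.closure (Set.range g) = G) (v : Fin n → ℝ) :
    IsNowhereDense (linearOrbit G v) := by
  by_contra hne
  have hne' : (interior (closure (linearOrbit G v))).Nonempty := Set.nonempty_iff_ne_empty.2 hne
  let S : Subalgebra ℝ (Matrix (Fin n) (Fin n) ℝ) := Algebra.adjoin ℝ (Units.val '' (G : Set _))
  have hGS : ∀ A ∈ G, (A : Matrix (Fin n) (Fin n) ℝ) ∈ S := fun A hA =>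
    Algebra.subset_adjoin ⟨A, hA, rfl⟩
  have hcomm : ∀ a b : S, a * b = b * a := by
    have := Algebra.isMulCommutative_adjoin ℝ (s := Units.val '' (G : Set (GL (Fin n) ℝ))) (by
      rintro _ ⟨a, ha, rfl⟩ _ ⟨b, hb, rfl⟩
      exact congrArg Units.val (hG a ha b hb))
    exact this.is_comm.comm
  let : NormedCommRing S := { (inferInstance : NormedRing S) with mul_comm := hcomm }
  let ev : S →ₗ[ℝ] (Fin n → ℝ) :=
    { toFun := fun a => a.1 *ᵥ v
      map_add' := fun a b => Matrix.add_mulVec _ _ _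
      map_smul' := fun c a => Matrix.smul_mulVec _ _ _ }
  -- The range is a closed subspace containing the orbit, so it has nonempty interior.
  have hsurj : Function.Surjective ev := by
    rw [← LinearMap.range_eq_top]
    refine Submodule.eq_top_of_nonempty_interior' _ (hne'.mono (interior_mono ?_))
    refine (Submodule.closed_of_finiteDimensional _).closure_subset_iff.2 ?_
    rintro _ ⟨A, hA, rfl⟩
    exact ⟨⟨A, hGS A hA⟩, rfl⟩
  -- If `a v = 0`, then `a (b v) = b (a v) = 0`, and the vectors `b v` exhaust `ℝⁿ`.
  have hinj : Function.Injective ev := by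
    refine (injective_iff_map_eq_zero ev).2 fun a ha => Subtype.ext ?_
    refine Matrix.ext_of_mulVec_single fun i => ?_
    obtain ⟨b, hb⟩ := hsurj (Pi.single i 1)
    have hb' : b.1 *ᵥ v = Pi.single i 1 := hb
    have ha' : a.1 *ᵥ v = 0 := ha
    have hab : a.1 * b.1 = b.1 * a.1 := congrArg Subtype.val (hcomm a b)
    rw [← hb', Matrix.mulVec_mulVec, hab, ← Matrix.mulVec_mulVec, ha', Matrix.mulVec_zero]
    simp
  let e : S ≃ₗ[ℝ] (Fin n → ℝ) := LinearEquiv.ofBijective ev ⟨hinj, hsurj⟩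
  have hrank : Module.finrank ℝ S = n := by simpa using e.finrank_eq
  have : Nontrivial S := Module.nontrivial_of_finrank_pos (R := ℝ) (by omega)
  have hgG : ∀ i, g i ∈ G := fun i => hgen ▸ Subgroup.subset_closure ⟨i, rfl⟩
  let u : Fin p → Sˣ := fun i =>
    ⟨⟨g i, hGS _ (hgG i)⟩, ⟨((g i)⁻¹ : GL (Fin n) ℝ), hGS _ (G.inv_mem (hgG i))⟩,
      Subtype.ext (g i).mul_inv, Subtype.ext (g i).inv_mul⟩
  have hGu : ∀ A ∈ G, ∃ w ∈ Subgroup.closure (Set.range u), Units.map (S.val : S →* _) w = A := by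
    intro A hA
    rw [← hgen] at hA
    have : Subgroup.closure (Set.range g) ≤
        (Subgroup.closure (Set.range u)).map (Units.map (S.val : S →* _)) := by
      rw [Subgroup.closure_le]
      rintro _ ⟨i, rfl⟩
      exact ⟨u i, Subgroup.subset_closure ⟨i, rfl⟩, Units.ext rfl⟩
    exact this hA
  let Φ : η.BlockAlgebra →ₐ[ℝ] Matrix (Fin n) (Fin n) ℝ :=
    (MulSemiringAction.toAlgEquiv ℝ (Matrix (Fin n) (Fin n) ℝ)
      (ConjAct.toConjAct P)).toAlgHom.comp η.toMatrix
  have hΦ : Function.Injective Φ :=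
    (MulSemiringAction.toAlgEquiv ℝ (Matrix (Fin n) (Fin n) ℝ)
      (ConjAct.toConjAct P)).injective.comp η.toMatrix_injective
  have hSΦ : S ≤ Φ.range := by
    refine Algebra.adjoin_le ?_
    rintro _ ⟨A, hA, rfl⟩
    obtain ⟨x, hx⟩ := η.K_subset_range_toMatrix (hP A hA)
    refine ⟨x, ?_⟩
    change ConjAct.toConjAct P • η.toMatrix x = A
    rw [hx, ConjAct.units_smul_def, ConjAct.ofConjAct_toConjAct]
    change ((P * (P⁻¹ * A * P) * P⁻¹ : GL (Fin n) ℝ) : Matrix (Fin n) (Fin n) ℝ) = A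
    congr 1
    group
  -- Conjugation by `P` places `S` inside the block algebra, whose characters pull back to `S`;
  -- injectivity of `ρ` lets nilpotency descend.
  let ρ : S →ₐ[ℝ] η.BlockAlgebra :=
    (AlgEquiv.ofInjective Φ hΦ).symm.toAlgHom.comp (Subalgebra.inclusion hSΦ)
  have hρ : Function.Injective ρ :=
    (AlgEquiv.ofInjective Φ hΦ).symm.injective.comp (Subalgebra.inclusion_injective hSΦ)
  have hnd := isNowhereDense_image_units_closure (fun k => (η.realChar k).comp ρ)
    (fun l => (η.complexChar l).comp ρ)
    (fun a h1 h2 => (IsNilpotent.map_iff hρ).1 (η.isNilpotent_of_char_eq_zero h1 h2)) u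
    (hp.trans hrank.ge) e
  refine hne'.ne_empty ((hnd.mono ?_ : IsNowhereDense (linearOrbit G v)))
  rintro _ ⟨A, hA, rfl⟩
  obtain ⟨w, hw, hwA⟩ := hGu A hA
  refine ⟨w, ⟨w, hw, rfl⟩, ?_⟩
  change (w : S).1 *ᵥ v = _
  rw [← hwA]
  rfl

end Orbit

theorem corollary1p6 {n r s p : ℕ} (hn : 1 ≤ n) (η : BlockSizes n r s)
    (G : Subgroup (GL (Fin n) ℝ)) (hG : ∀ A ∈ G, ∀ B ∈ G, A * B = B * A)
    (P : GL (Fin n) ℝ) (hP : ∀ A ∈ G, P⁻¹ * A * P ∈ η.KStar)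
    (hp : p + s ≤ n)
    (hgen : ∃ A : Fin p → GL (Fin n) ℝ, Subgroup.closure (Set.range A) = G) :
    (∀ v : Fin n → ℝ, IsNowhereDense (linearOrbit G v)) ∧ ¬ IsTopologicallyTransitive G := by
  obtain ⟨g, hg⟩ := hgen
  have hnd := isNowhereDense_linearOrbit hn η G hG P hP hp g hg
  refine ⟨hnd, ?_⟩
  rintro ⟨v, hv⟩
  have h := hnd v
  rw [IsNowhereDense, hv.closure_eq, interior_univ] at h
  exact Set.univ_nonempty.ne_empty h
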